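/- Let $d\ge 1$, let $\Omega\subset\mathbb{R}^d$ be a bounded open set (no regularity of $\partial\Omega$ is assumed), and let $\theta\in\mathbb{R}^d$ with $|\theta|=1$. Let $u\in L^2(\Omega)$ be a real-valued function having a weak derivative $\partial_\theta u\in L^2(\Omega)$ along $\theta$, i.e. $\int_\Omega u\,(\theta\cdot\nabla\varphi)\,dx=-\int_\Omega \partial_\theta u\,\varphi\,dx$ for all $\varphi\in C_c^\infty(\Omega)$. Let $H_\theta=\{y\in\mathbb{R}^d: y\cdot\theta=0\}$, equipped with its $(d-1)$-dimensional Lebesgue measure $\lambda^{d-1}$ (the unit point mass if $d=1$), let $P_\theta(\Omega)\subset H_\theta$ be the orthogonal projection of $\Omega$ onto $H_\theta$, and for $y\in H_\theta$ let $\omega_\theta(y)=\{s\in\mathbb{R}: s\theta+y\in\Omega\}$, a bounded open subset of $\mathbb{R}$. Then there exists a function $g:\partial\Omega\to\mathbb{R}$, measurable for the Borel $\sigma$-algebra of $\partial\Omega$, which is a directional trace of $u$ in the direction $\theta$; that is, there exist a representative of $u$, again denoted by $u$, and a set $A\subset P_\theta(\Omega)$ with $\lambda^{d-1}(P_\theta(\Omega)\setminus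 A)=0$ such that for every $y\in A$: 1. the function $u_{\theta,y}: s\mapsto u(s\theta+y)$ belongs to $H^1(\omega_\theta(y))$; 2. for every connected component $]\alpha,\beta[$ of $\omega_\theta(y)$, the function $u_{\theta,y}$ is continuous on $]\alpha,\beta[$ and extends continuously to $]\alpha,\beta]$, and the value of this extension at $\beta$ is $g(\beta\theta+y)$ (where $\beta\theta+y\in\partial\Omega$). -/

import Mathlib

open MeasureTheory Set Filter Topology
open scoped ContDiff

/-- `v` is the directional derivative of `u` along `θ` on `Ω` in the weak sense:
`∫_Ω u ∂_θ φ = - ∫_Ω v φ` for all `φ ∈ C_c^∞(Ω)`. -/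
def HasWeakDirDeriv {E : Type*} [NormedAddCommGroup E] [NormedSpace ℝ E] [MeasureSpace E]
    (Ω : Set E) (θ : E) (u v : E → ℝ) : Prop :=
  ∀ φ : E → ℝ, ContDiff ℝ ∞ φ → HasCompactSupport φ → tsupport φ ⊆ Ω →
    ∫ x in Ω, u x * fderiv ℝ φ x θ = - ∫ x in Ω, v x * φ x

/-- `u` represents an element of `W_θ(Ω)`: `u ∈ L²(Ω)` and `∂_θ u ∈ L²(Ω)`. -/
def MemW {E : Type*} [NormedAddCommGroup E] [NormedSpace ℝ E] [MeasureSpace E]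
    (Ω : Set E) (θ : E) (u : E → ℝ) : Prop :=
  MemLp u 2 (volume.restrict Ω) ∧
    ∃ v : E → ℝ, MemLp v 2 (volume.restrict Ω) ∧ HasWeakDirDeriv Ω θ u v

/-- `f` represents an element of `H¹(U)`, for `U ⊆ ℝ` open
(on the real line, `fderiv ℝ φ s 1 = deriv φ s`). -/
def MemH1 (U : Set ℝ) (f : ℝ → ℝ) : Prop :=
  MemW U (1 : ℝ) f

/-- The hyperplane `H_θ` through `0` orthogonal to `θ`. -/
noncomputable abbrev hyperplane {d : ℕ} (θ : EuclideanSpace ℝ (Fin d)) :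
    Submodule ℝ (EuclideanSpace ℝ (Fin d)) :=
  (Submodule.span ℝ {θ})ᗮ

/-- The Lebesgue measure `λ^{d-1}` of the Euclidean space `H_θ`. The instance is given explicitly,
since the restriction of the `d`-dimensional Lebesgue measure to the subtype `H_θ` is zero. -/
noncomputable def hyperplaneMeasure {d : ℕ} (θ : EuclideanSpace ℝ (Fin d)) :
    Measure (hyperplane θ) :=
  (measureSpaceOfInnerProductSpace (E := hyperplane θ)).volume

/-- The orthogonal projection `P_θ(Ω) ⊆ H_θ` of `Ω`. -/
noncomputable def shadow {d : ℕ} (Ω : Set (EuclideanSpace ℝ (Fin d)))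
    (θ : EuclideanSpace ℝ (Fin d)) : Set (hyperplane θ) :=
  (hyperplane θ).orthogonalProjectionOnto '' Ω

/-- `ω_θ(y) = {s : s θ + y ∈ Ω}`. -/
def lineSection {d : ℕ} (Ω : Set (EuclideanSpace ℝ (Fin d))) (θ : EuclideanSpace ℝ (Fin d))
    (y : hyperplane θ) : Set ℝ :=
  {s : ℝ | s • θ + (y : EuclideanSpace ℝ (Fin d)) ∈ Ω}

/-- The pairs of endpoints `(α, β)` of the bounded open intervals `]α, β[` that are connected
components of the open set `U ⊆ ℝ`. -/
def componentIntervals (U : Set ℝ) : Set (ℝ × ℝ) :=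
  {p | p.1 < p.2 ∧ Ioo p.1 p.2 ⊆ U ∧ p.1 ∉ U ∧ p.2 ∉ U}

/-- `g : ∂Ω → ℝ` is a directional trace of `u` in the direction `θ`: for some representative `u'`
of `u` and `λ^{d-1}`-almost every `y ∈ P_θ(Ω)`, the function `s ↦ u' (s θ + y)` is in `H¹(ω_θ(y))`
and, for each component `]α, β[` of `ω_θ(y)`, it extends from `]α, β[` to a continuous function
`f` on `]α, β]` with `f β = g (β θ + y)`. -/
def IsDirectionalTrace {d : ℕ} (Ω : Set (EuclideanSpace ℝ (Fin d)))
    (θ : EuclideanSpace ℝ (Fin d)) (u : EuclideanSpace ℝ (Fin d) → ℝ)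
    (g : frontier Ω → ℝ) : Prop :=
  ∃ u' : EuclideanSpace ℝ (Fin d) → ℝ, u' =ᵐ[volume.restrict Ω] u ∧
    ∃ A : Set (hyperplane θ), A ⊆ shadow Ω θ ∧ hyperplaneMeasure θ (shadow Ω θ \ A) = 0 ∧
      ∀ y ∈ A,
        MemH1 (lineSection Ω θ y) (fun s => u' (s • θ + (y : EuclideanSpace ℝ (Fin d)))) ∧
        ∀ α β : ℝ, (α, β) ∈ componentIntervals (lineSection Ω θ y) →
          ∃ f : ℝ → ℝ, ContinuousOn f (Ioc α β) ∧
            (∀ s ∈ Ioo α β, f s = u' (s • θ + (y : EuclideanSpace ℝ (Fin d)))) ∧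
            ∃ h : β • θ + (y : EuclideanSpace ℝ (Fin d)) ∈ frontier Ω, g ⟨_, h⟩ = f β

/-!
In the coordinates `(s, y) ↦ s θ + y`, test the weak derivative against products `η(s) ψ(y)`: for
fixed `η`, almost every `y` satisfies the one-dimensional identity for `η`. Letting `η` run through
a countable dense family in the `C¹` topology shows that almost every section of `u` is in `H¹`.
On an interval of its domain such a section agrees almost everywhere with a function which is
continuous up to the endpoints (du Bois-Reymond). The upper limit of the averages of `u` over the
segments `[x - θ / n, x]` is therefore a Borel function on all of `ℝ^d` which on almost every line
equals this continuous function, the right endpoint `β` included; it serves both as the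
representative of `u` and, on `∂Ω`, as the trace.
-/

section TestFunctions

variable {X : Type*} [TopologicalSpace X] [MeasurableSpace X] {μ : Measure X} {U : Set X}
  {f φ : X → ℝ}

theorem setIntegral_mul_of_tsupport_subset (hφU : tsupport φ ⊆ U) :
    ∫ x in U, f x * φ x ∂μ = ∫ x, f x * φ x ∂μ :=
  setIntegral_eq_integral_of_forall_compl_eq_zero fun x hx => by
    rw [image_eq_zero_of_notMem_tsupport fun hxφ => hx (hφU hxφ), mul_zero]

theorem integrable_mul_of_tsupport_subset [OpensMeasurableSpace X] [T2Space X]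
    (hf : LocallyIntegrableOn f U μ) (hφ : Continuous φ) (hφc : HasCompactSupport φ)
    (hφU : tsupport φ ⊆ U) : Integrable (fun x => f x * φ x) μ := by
  have hK : IntegrableOn (fun x => f x * φ x) (tsupport φ) μ :=
    (hf.integrableOn_compact_subset hφU hφc).mul_continuousOn hφ.continuousOn hφc
  exact (integrableOn_iff_integrable_of_support_subset
    ((Function.support_mul_subset_right f φ).trans (subset_tsupport φ))).1 hK

theorem continuous_fderiv_apply_of_contDiff {E : Type*} [NormedAddCommGroup E] [NormedSpace ℝ E]
    {φ : E → ℝ} (hφ : ContDiff ℝ ∞ φ) (θ : E) : Continuous fun x => fderiv ℝ φ x θ :=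
  (hφ.continuous_fderiv (by simp)).clm_apply continuous_const

end TestFunctions

section WeakDerivative

variable {E : Type*} [NormedAddCommGroup E] [NormedSpace ℝ E] [MeasureSpace E]
  {Ω Ω' : Set E} {θ : E} {u u' v v' : E → ℝ}

theorem hasWeakDirDeriv_iff_integral : HasWeakDirDeriv Ω θ u v ↔
    ∀ φ : E → ℝ, ContDiff ℝ ∞ φ → HasCompactSupport φ → tsupport φ ⊆ Ω →
      ∫ x, u x * fderiv ℝ φ x θ = - ∫ x, v x * φ x := by
  refine forall₄_congr fun φ _ _ hφΩ => ?_
  rw [setIntegral_mul_of_tsupport_subset hφΩ,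
    setIntegral_mul_of_tsupport_subset ((tsupport_fderiv_apply_subset ℝ θ).trans hφΩ)]

theorem HasWeakDirDeriv.mono (h : HasWeakDirDeriv Ω θ u v) (hΩ : Ω' ⊆ Ω) :
    HasWeakDirDeriv Ω' θ u v :=
  hasWeakDirDeriv_iff_integral.2 fun φ hφ hφc hφΩ =>
    hasWeakDirDeriv_iff_integral.1 h φ hφ hφc (hφΩ.trans hΩ)

theorem HasWeakDirDeriv.congr_ae (h : HasWeakDirDeriv Ω θ u v)
    (hu : u' =ᵐ[volume.restrict Ω] u) (hv : v' =ᵐ[volume.restrict Ω] v) :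
    HasWeakDirDeriv Ω θ u' v' := by
  intro φ hφ hφc hφΩ
  calc ∫ x in Ω, u' x * fderiv ℝ φ x θ = ∫ x in Ω, u x * fderiv ℝ φ x θ :=
        integral_congr_ae (hu.mul (ae_eq_refl fun x => fderiv ℝ φ x θ))
    _ = - ∫ x in Ω, v x * φ x := h φ hφ hφc hφΩ
    _ = - ∫ x in Ω, v' x * φ x :=
        congrArg Neg.neg (integral_congr_ae (hv.symm.mul (ae_eq_refl φ)))

theorem HasWeakDirDeriv.sub [OpensMeasurableSpace E] (h : HasWeakDirDeriv Ω θ u v)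
    (h' : HasWeakDirDeriv Ω θ u' v')
    (hu : LocallyIntegrableOn u Ω) (hv : LocallyIntegrableOn v Ω)
    (hu' : LocallyIntegrableOn u' Ω) (hv' : LocallyIntegrableOn v' Ω) :
    HasWeakDirDeriv Ω θ (u - u') (v - v') := by
  rw [hasWeakDirDeriv_iff_integral] at h h' ⊢
  intro φ hφ hφc hφΩ
  have hdφ := continuous_fderiv_apply_of_contDiff hφ θ
  have hdφc : HasCompactSupport fun x => fderiv ℝ φ x θ := hφc.fderiv_apply (𝕜 := ℝ) θ
  have hdφΩ := (tsupport_fderiv_apply_subset (𝕜 := ℝ) (f := φ) θ).trans hφΩ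
  simp only [Pi.sub_apply, sub_mul]
  rw [integral_sub (integrable_mul_of_tsupport_subset hu hdφ hdφc hdφΩ)
      (integrable_mul_of_tsupport_subset hu' hdφ hdφc hdφΩ),
    integral_sub (integrable_mul_of_tsupport_subset hv hφ.continuous hφc hφΩ)
      (integrable_mul_of_tsupport_subset hv' hφ.continuous hφc hφΩ),
    h φ hφ hφc hφΩ, h' φ hφ hφc hφΩ, neg_sub_neg, neg_sub]

theorem MemW.mono (h : MemW Ω θ u) (hΩ : Ω' ⊆ Ω) : MemW Ω' θ u := by
  obtain ⟨hu, v, hv, hweak⟩ := h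
  have hle : volume.restrict Ω' ≤ volume.restrict Ω := Measure.restrict_mono hΩ le_rfl
  exact ⟨hu.mono_measure hle, v, hv.mono_measure hle, hweak.mono hΩ⟩

theorem MemW.congr_ae (h : MemW Ω θ u) (hu' : u' =ᵐ[volume.restrict Ω] u) : MemW Ω θ u' := by
  obtain ⟨hu, v, hv, hweak⟩ := h
  exact ⟨hu.ae_eq hu'.symm, v, hv, hweak.congr_ae hu' (ae_eq_refl v)⟩

variable {F : Type*} [NormedAddCommGroup F] [NormedSpace ℝ F] [MeasureSpace F] [BorelSpace F]

theorem HasWeakDirDeriv.comp_continuousLinearEquiv [BorelSpace E] (Φ : F ≃L[ℝ] E)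
    (hΦ : MeasurePreserving Φ) {w : F} (h : HasWeakDirDeriv Ω (Φ w) u v) :
    HasWeakDirDeriv (Φ ⁻¹' Ω) w (u ∘ Φ) (v ∘ Φ) := by
  rw [hasWeakDirDeriv_iff_integral] at h ⊢
  intro φ hφ hφc hφΩ
  have hsupp : tsupport (φ ∘ Φ.symm) = Φ.symm ⁻¹' tsupport φ :=
    tsupport_comp_eq_preimage φ Φ.symm.toHomeomorph
  have hsub : tsupport (φ ∘ Φ.symm) ⊆ Ω := fun x hx => by
    rw [hsupp] at hx
    simpa using hφΩ hx
  have hderiv : ∀ p, fderiv ℝ (φ ∘ Φ.symm) (Φ p) (Φ w) = fderiv ℝ φ p w := fun p => by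
    rw [Φ.symm.comp_right_fderiv]
    simp
  have hkey := h (φ ∘ Φ.symm) (hφ.comp Φ.symm.contDiff)
    (hφc.comp_homeomorph Φ.symm.toHomeomorph) hsub
  rw [← hΦ.integral_comp Φ.toHomeomorph.measurableEmbedding,
    ← hΦ.integral_comp Φ.toHomeomorph.measurableEmbedding] at hkey
  simpa only [hderiv, Function.comp_apply, ContinuousLinearEquiv.symm_apply_apply] using hkey

theorem MemW.comp_continuousLinearEquiv [BorelSpace E] (Φ : F ≃L[ℝ] E)
    (hΦ : MeasurePreserving Φ) {w : F} (h : MemW Ω (Φ w) u) : MemW (Φ ⁻¹' Ω) w (u ∘ Φ) := by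
  obtain ⟨hu, v, hv, hweak⟩ := h
  have hΦΩ := hΦ.restrict_preimage_emb Φ.toHomeomorph.measurableEmbedding Ω
  exact ⟨hu.comp_measurePreserving hΦΩ, v ∘ Φ, hv.comp_measurePreserving hΦΩ,
    hweak.comp_continuousLinearEquiv Φ hΦ⟩

end WeakDerivative

section Interval

variable {a b : ℝ} {f v : ℝ → ℝ}

theorem exists_subset_Icc_of_isCompact_subset_Ioo {K : Set ℝ} (hK : IsCompact K)
    (hKab : K ⊆ Ioo a b) (hab : a < b) : ∃ c ∈ Ioo a b, ∃ e ∈ Ioo a b, K ⊆ Icc c e := by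
  rcases K.eq_empty_or_nonempty with rfl | hne
  · obtain ⟨c, hc⟩ := exists_between hab
    exact ⟨c, hc, c, hc, empty_subset _⟩
  · obtain ⟨c, hcK, hc⟩ := hK.exists_isLeast hne
    obtain ⟨e, heK, he⟩ := hK.exists_isGreatest hne
    exact ⟨c, hKab hcK, e, hKab heK, fun s hs => ⟨hc hs, he hs⟩⟩

theorem support_integral_subset_Icc {η : ℝ → ℝ} {c e : ℝ} (hac : a < c)
    (hη : Function.support η ⊆ Icc c e) (h0 : ∫ t, η t = 0) :
    (Function.support fun s => ∫ t in a..s, η t) ⊆ Icc c e := by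
  refine Function.support_subset_iff'.2 fun s hs => ?_
  have hzero : ∀ t, t ∉ Icc c e → η t = 0 := Function.support_subset_iff'.1 hη
  rcases lt_or_ge s c with hsc | hcs
  · refine intervalIntegral.integral_zero_ae (ae_of_all _ fun t ht => hzero t fun htI => ?_)
    exact (ht.2.trans_lt (max_lt hac hsc)).not_ge htI.1
  · have hes : e < s := not_le.1 fun hse => hs ⟨hcs, hse⟩
    rw [← h0]
    exact intervalIntegral.integral_eq_integral_of_support_subset
      (hη.trans fun t ht => ⟨hac.trans_le ht.1, ht.2.trans hes.le⟩)

theorem exists_contDiff_deriv_eq_of_integral_eq_zero (hab : a < b) {η : ℝ → ℝ}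
    (hη : ContDiff ℝ ∞ η) (hηc : HasCompactSupport η) (hηab : tsupport η ⊆ Ioo a b)
    (h0 : ∫ s, η s = 0) :
    ∃ Ψ : ℝ → ℝ, ContDiff ℝ ∞ Ψ ∧ HasCompactSupport Ψ ∧ tsupport Ψ ⊆ Ioo a b ∧
      deriv Ψ = η := by
  obtain ⟨c, hc, e, he, hce⟩ := exists_subset_Icc_of_isCompact_subset_Ioo hηc hηab hab
  have hderiv : ∀ s, HasDerivAt (fun s => ∫ t in a..s, η t) (η s) s :=
    fun s => (hη.continuous.integral_hasStrictDerivAt a s).hasDerivAt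
  have hsupp := support_integral_subset_Icc hc.1 ((subset_tsupport η).trans hce) h0
  refine ⟨_, ?_, .of_support_subset_isCompact isCompact_Icc hsupp,
    (closure_minimal hsupp isClosed_Icc).trans (Icc_subset_Ioo hc.1 he.2),
    funext fun s => (hderiv s).deriv⟩
  rw [contDiff_infty_iff_deriv, funext fun s => (hderiv s).deriv]
  exact ⟨fun s => (hderiv s).differentiableAt, hη⟩

theorem HasWeakDirDeriv.integral_mul_integral_comm (hab : a < b)
    (h : HasWeakDirDeriv (Ioo a b) 1 f 0) (hf : LocallyIntegrableOn f (Ioo a b)) {φ r : ℝ → ℝ}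
    (hφ : ContDiff ℝ ∞ φ) (hφc : HasCompactSupport φ) (hφab : tsupport φ ⊆ Ioo a b)
    (hr : ContDiff ℝ ∞ r) (hrc : HasCompactSupport r) (hrab : tsupport r ⊆ Ioo a b) :
    (∫ s, r s) * ∫ s, f s * φ s = (∫ s, φ s) * ∫ s, f s * r s := by
  set R := ∫ s, r s
  set J := ∫ s, φ s
  have hφi : Integrable φ := hφ.continuous.integrable_of_hasCompactSupport hφc
  have hri : Integrable r := hr.continuous.integrable_of_hasCompactSupport hrc
  obtain ⟨Ψ, hΨ, hΨc, hΨab, hΨderiv⟩ := exists_contDiff_deriv_eq_of_integral_eq_zero hab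
    (η := fun s => R * φ s - J * r s) ((contDiff_const.mul hφ).sub (contDiff_const.mul hr))
    ((hφc.mul_left (f := fun _ => R)).sub (hrc.mul_left (f := fun _ => J)))
    ((tsupport_sub _ _).trans (union_subset (tsupport_mul_subset_right.trans hφab)
      (tsupport_mul_subset_right.trans hrab)))
    (by rw [integral_sub (hφi.const_mul R) (hri.const_mul J), integral_const_mul,
      integral_const_mul, mul_comm, sub_self])
  have hΨ0 : ∫ s, f s * (R * φ s - J * r s) = 0 := by
    simpa [fderiv_eq_smul_deriv, hΨderiv] using hasWeakDirDeriv_iff_integral.1 h Ψ hΨ hΨc hΨab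
  have hfφ := integrable_mul_of_tsupport_subset hf hφ.continuous hφc hφab
  have hfr := integrable_mul_of_tsupport_subset hf hr.continuous hrc hrab
  simp only [mul_sub, mul_left_comm (f _)] at hΨ0
  rw [integral_sub (hfφ.const_mul R) (hfr.const_mul J), integral_const_mul,
    integral_const_mul] at hΨ0
  exact sub_eq_zero.1 hΨ0

theorem HasWeakDirDeriv.exists_ae_eq_const (hab : a < b)
    (h : HasWeakDirDeriv (Ioo a b) 1 f 0) (hf : LocallyIntegrableOn f (Ioo a b)) :
    ∃ c : ℝ, f =ᵐ[volume.restrict (Ioo a b)] fun _ => c := by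
  obtain ⟨r, hrab, hrc, hr, hr0, hr1⟩ := exists_contDiff_tsupport_subset (n := ⊤)
    (isOpen_Ioo.mem_nhds (⟨left_lt_add_div_two.2 hab, add_div_two_lt_right.2 hab⟩ :
      (a + b) / 2 ∈ Ioo a b))
  have hR : ∫ s, r s ≠ 0 := ne_of_gt <|
    hr.continuous.integral_pos_of_hasCompactSupport_nonneg_nonzero hrc
      (fun s => (hr0 ⟨s, rfl⟩).1) (x := (a + b) / 2) (by simp [hr1])
  set c := (∫ s, f s * r s) / ∫ s, r s with hc
  refine ⟨c, (ae_restrict_iff' measurableSet_Ioo).2 ?_⟩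
  have hfc : LocallyIntegrableOn (fun s => f s - c) (Ioo a b) :=
    hf.sub (continuous_const.locallyIntegrable.locallyIntegrableOn _)
  suffices ∀ᵐ s, s ∈ Ioo a b → f s - c = 0 by simpa only [sub_eq_zero] using this
  refine isOpen_Ioo.ae_eq_zero_of_integral_contDiff_smul_eq_zero hfc fun φ hφ hφc hφab => ?_
  have hφi : Integrable φ := hφ.continuous.integrable_of_hasCompactSupport hφc
  have hfφ := integrable_mul_of_tsupport_subset hf hφ.continuous hφc hφab
  calc ∫ s, φ s • (f s - c) = ∫ s, (f s * φ s - c * φ s) := by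
        congr! 2 with s
        rw [smul_eq_mul, mul_comm, sub_mul]
    _ = (∫ s, f s * φ s) - c * ∫ s, φ s := by
        rw [integral_sub hfφ (hφi.const_mul c), integral_const_mul]
    _ = 0 := by
        rw [hc, div_mul_eq_mul_div, sub_eq_zero, eq_div_iff hR, mul_comm,
          h.integral_mul_integral_comm hab hf hφ hφc hφab hr hrc hrab, mul_comm]

theorem hasWeakDirDeriv_integral (hab : a ≤ b) (hv : IntervalIntegrable v volume a b) :
    HasWeakDirDeriv (Ioo a b) 1 (fun s => ∫ t in a..s, v t) v := by
  intro φ hφ _ hφab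
  set V := fun s => ∫ t in a..s, v t
  have hVac : AbsolutelyContinuousOnInterval V a b :=
    hv.absolutelyContinuousOnInterval_intervalIntegral left_mem_uIcc
  have hVderiv : ∫ s in a..b, deriv V s * φ s = ∫ s in a..b, v s * φ s := by
    refine intervalIntegral.integral_congr_ae ?_
    filter_upwards [hv.ae_hasDerivAt_integral] with s hs hsab
    rw [(hs (uIoc_subset_uIcc hsab) a left_mem_uIcc).deriv]
  have hφa : φ a = 0 := image_eq_zero_of_notMem_tsupport fun h => (hφab h).1.false
  have hφb : φ b = 0 := image_eq_zero_of_notMem_tsupport fun h => (hφab h).2.false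
  have hparts := hVac.integral_mul_deriv_eq_deriv_mul
    (hφ.of_le (by simp)).contDiffOn.absolutelyContinuousOnInterval
  simpa [hφa, hφb, hVderiv, fderiv_eq_smul_deriv, intervalIntegral.integral_of_le hab,
    integral_Ioc_eq_integral_Ioo] using hparts

theorem HasWeakDirDeriv.exists_continuous_ae_eq (hab : a < b)
    (h : HasWeakDirDeriv (Ioo a b) 1 f v) (hf : LocallyIntegrableOn f (Ioo a b))
    (hv : IntegrableOn v (Ioo a b)) :
    ∃ F : ℝ → ℝ, Continuous F ∧ f =ᵐ[volume.restrict (Ioo a b)] F := by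
  set v₀ := (Ioo a b).indicator v
  have hv₀ : Integrable v₀ := hv.integrable_indicator measurableSet_Ioo
  have hvv₀ : v =ᵐ[volume.restrict (Ioo a b)] v₀ :=
    (indicator_ae_eq_restrict measurableSet_Ioo).symm
  set V := fun s => ∫ t in a..s, v₀ t
  have hV : Continuous V := intervalIntegral.continuous_primitive
    (fun _ _ => hv₀.intervalIntegrable) a
  have hVv : HasWeakDirDeriv (Ioo a b) 1 V v :=
    (hasWeakDirDeriv_integral hab.le hv₀.intervalIntegrable).congr_ae (ae_eq_refl V) hvv₀
  have hVloc : LocallyIntegrableOn V (Ioo a b) := hV.locallyIntegrable.locallyIntegrableOn _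
  have hsub := h.sub hVv hf hv.locallyIntegrableOn hVloc hv.locallyIntegrableOn
  rw [sub_self] at hsub
  obtain ⟨c, hc⟩ := hsub.exists_ae_eq_const hab (hf.sub hVloc)
  refine ⟨fun s => c + V s, continuous_const.add hV, ?_⟩
  filter_upwards [hc] with s hs using sub_eq_iff_eq_add.1 hs

end Interval

section LeftLimit

/-- The left limit of `u` at `x` along `θ`, read off from averages over the segments
`[x - t θ, x]` so that it depends only on the class of `u` up to almost everywhere equality on
lines; the upper limit makes it total and Borel measurable, with the junk value of `limsup` in `ℝ`
where the averages are unbounded. -/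
noncomputable def leftLimit {E : Type*} [AddCommGroup E] [Module ℝ E] (θ : E) (u : E → ℝ)
    (x : E) : ℝ :=
  limsup (fun n : ℕ => ⨍ t in (0 : ℝ)..1 / (n + 1), u (x - t • θ)) atTop

theorem leftLimit_line {E : Type*} [AddCommGroup E] [Module ℝ E] (θ : E) (u : E → ℝ)
    (s : ℝ) (y : E) :
    leftLimit θ u (s • θ + y) = leftLimit (1 : ℝ) (fun t => u (t • θ + y)) s := by
  simp only [leftLimit, smul_eq_mul, mul_one, sub_smul, sub_add_eq_add_sub]

theorem measurable_leftLimit {E : Type*} [NormedAddCommGroup E] [NormedSpace ℝ E]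
    [MeasurableSpace E] [BorelSpace E] [SecondCountableTopology E] (θ : E) {u : E → ℝ}
    (hu : Measurable u) : Measurable (leftLimit θ u) := by
  refine Measurable.limsup fun n => ?_
  have hmeas : StronglyMeasurable (Function.uncurry fun (x : E) (t : ℝ) => u (x - t • θ)) :=
    (hu.comp (by fun_prop)).stronglyMeasurable
  simp only [setAverage_eq, smul_eq_mul]
  exact hmeas.integral_prod_right.measurable.const_mul _

variable {a b s : ℝ} {f F : ℝ → ℝ}

theorem tendsto_left_average (hF : Continuous F) (s : ℝ) :
    Tendsto (fun r => ⨍ t in (0 : ℝ)..r, F (s - t)) (𝓝[>] 0) (𝓝 (F s)) := by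
  have hc : Continuous fun t => F (s - t) := by fun_prop
  have h := (hc.integral_hasStrictDerivAt 0 0).hasDerivAt.hasDerivWithinAt (s := Ioi 0)
  rw [sub_zero, hasDerivWithinAt_iff_tendsto_slope' self_notMem_Ioi] at h
  simpa [slope_fun_def, interval_average_eq] using h

theorem leftLimit_eq_of_ae_eq (hF : Continuous F) (hfF : f =ᵐ[volume.restrict (Ioo a b)] F)
    (hs : s ∈ Ioc a b) : leftLimit (1 : ℝ) f s = F s := by
  have havg : ∀ᶠ r in 𝓝[>] (0 : ℝ),
      ⨍ t in (0 : ℝ)..r, F (s - t) = ⨍ t in (0 : ℝ)..r, f (s - t) := by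
    filter_upwards [Ioo_mem_nhdsGT (sub_pos.2 hs.1)] with r hr
    refine average_congr ((ae_restrict_iff' measurableSet_uIoc).2 ?_)
    filter_upwards [(volume.measurePreserving_sub_left s).quasiMeasurePreserving.ae
      ((ae_restrict_iff' measurableSet_Ioo).1 hfF)] with t ht htr
    rw [uIoc_of_le hr.1.le] at htr
    exact (ht ⟨by linarith [htr.2, hr.2], by linarith [htr.1, hs.2]⟩).symm
  have hseq : Tendsto (fun n : ℕ => 1 / ((n : ℝ) + 1)) atTop (𝓝[>] 0) :=
    tendsto_nhdsWithin_iff.2 ⟨tendsto_one_div_add_atTop_nhds_zero_nat,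
      Eventually.of_forall fun n => mem_Ioi.2 Nat.one_div_pos_of_nat⟩
  simpa only [leftLimit, smul_eq_mul, mul_one, Function.comp_def] using
    (((tendsto_left_average hF s).congr' havg).comp hseq).limsup_eq

theorem MemH1.exists_continuous_ae_eq_eqOn_leftLimit {I : Set ℝ} (h : MemH1 I f) (hab : a < b)
    (hI : Ioo a b ⊆ I) :
    ∃ F : ℝ → ℝ, Continuous F ∧ f =ᵐ[volume.restrict (Ioo a b)] F ∧
      EqOn (leftLimit (1 : ℝ) f) F (Ioc a b) := by
  obtain ⟨hf, v, hv, hweak⟩ := MemW.mono h hI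
  have hfi : IntegrableOn f (Ioo a b) := hf.integrable one_le_two
  obtain ⟨F, hF, hfF⟩ :=
    hweak.exists_continuous_ae_eq hab hfi.locallyIntegrableOn (hv.integrable one_le_two)
  exact ⟨F, hF, hfF, fun s hs => leftLimit_eq_of_ae_eq hF hfF hs⟩

theorem MemH1.continuousOn_leftLimit {I : Set ℝ} (h : MemH1 I f) (hab : a < b)
    (hI : Ioo a b ⊆ I) : ContinuousOn (leftLimit (1 : ℝ) f) (Ioc a b) := by
  obtain ⟨F, hF, -, hlim⟩ := h.exists_continuous_ae_eq_eqOn_leftLimit hab hI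
  exact hF.continuousOn.congr hlim

theorem MemH1.leftLimit_ae_eq {I : Set ℝ} (h : MemH1 I f) (hI : IsOpen I) :
    leftLimit (1 : ℝ) f =ᵐ[volume.restrict I] f := by
  rw [EventuallyEq, ae_restrict_iff' hI.measurableSet, ae_iff]
  refine measure_null_of_locally_null _ fun s hs => ?_
  obtain ⟨a, b, hsab, hab⟩ :=
    mem_nhds_iff_exists_Ioo_subset.1 (hI.mem_nhds (Classical.not_imp.1 hs).1)
  obtain ⟨F, -, hfF, hlim⟩ := h.exists_continuous_ae_eq_eqOn_leftLimit (hsab.1.trans hsab.2) hab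
  refine ⟨_, inter_mem_nhdsWithin _ (Ioo_mem_nhds hsab.1 hsab.2),
    measure_mono_null ?_ (ae_iff.1 ((ae_restrict_iff' measurableSet_Ioo).1 hfF))⟩
  rintro t ⟨hne, ht⟩ hfFt
  exact hne fun _ => (hlim (Ioo_subset_Ioc_self ht)).trans (hfFt ht).symm

theorem MemH1.leftLimit {I : Set ℝ} (h : MemH1 I f) (hI : IsOpen I) :
    MemH1 I (leftLimit (1 : ℝ) f) :=
  MemW.congr_ae h (h.leftLimit_ae_eq hI)

end LeftLimit

section TensorTestFunctions

variable {X Y : Type*} [TopologicalSpace X] [TopologicalSpace Y] {η : X → ℝ} {ψ : Y → ℝ}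

theorem tsupport_fst_mul_snd_subset :
    tsupport (fun p : X × Y => η p.1 * ψ p.2) ⊆ tsupport η ×ˢ tsupport ψ :=
  closure_minimal (fun _ hp => ⟨subset_tsupport η (left_ne_zero_of_mul hp),
    subset_tsupport ψ (right_ne_zero_of_mul hp)⟩)
    ((isClosed_tsupport η).prod (isClosed_tsupport ψ))

theorem hasCompactSupport_fst_mul_snd (hη : HasCompactSupport η) (hψ : HasCompactSupport ψ) :
    HasCompactSupport fun p : X × Y => η p.1 * ψ p.2 :=
  (hη.isCompact.prod hψ.isCompact).of_isClosed_subset (isClosed_tsupport _)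
    tsupport_fst_mul_snd_subset

theorem fderiv_fst_mul_snd_apply {F H : Type*} [NormedAddCommGroup F] [NormedSpace ℝ F]
    [NormedAddCommGroup H] [NormedSpace ℝ H] {η : F → ℝ} {ψ : H → ℝ} (hη : Differentiable ℝ η)
    (hψ : Differentiable ℝ ψ) (w : F) (p : F × H) :
    fderiv ℝ (fun p : F × H => η p.1 * ψ p.2) p (w, 0) = fderiv ℝ η p.1 w * ψ p.2 := by
  have hη' : HasFDerivAt (fun p : F × H => η p.1) _ p :=
    (hη p.1).hasFDerivAt.comp p hasFDerivAt_fst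
  have hψ' : HasFDerivAt (fun p : F × H => ψ p.2) _ p :=
    (hψ p.2).hasFDerivAt.comp p hasFDerivAt_snd
  rw [(hη'.fun_mul hψ').fderiv]
  simp [mul_comm]

end TensorTestFunctions

section Fubini

variable {X Y : Type*} [MeasurableSpace X] [MeasurableSpace Y] {μ : Measure X} {ν : Measure Y}
  [SFinite μ] [SFinite ν] {u : X × Y → ℝ}

theorem ae_memLp_section {p : ENNReal} (hp0 : p ≠ 0) (hp : p ≠ ⊤) (hu : MemLp u p (μ.prod ν)) :
    ∀ᵐ y ∂ν, MemLp (fun x => u (x, y)) p μ := by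
  have hint := (integrable_norm_rpow_iff hu.1 hp0 hp).2 hu
  filter_upwards [hu.1.prodMk_right, hint.prod_left_ae] with y hy hinty
  exact (integrable_norm_rpow_iff hy hp0 hp).1 hinty

variable [TopologicalSpace X] [TopologicalSpace Y]

theorem ae_integrableOn_section [SigmaCompactSpace Y] (hu : LocallyIntegrable u (μ.prod ν))
    {K : Set X} (hK : IsCompact K) : ∀ᵐ y ∂ν, IntegrableOn (fun x => u (x, y)) K μ := by
  rw [← Measure.restrict_univ (μ := ν), ← iUnion_compactCovering, ae_restrict_iUnion_iff]
  intro m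
  have hint := hu.integrableOn_isCompact (hK.prod (isCompact_compactCovering Y m))
  rw [IntegrableOn, ← Measure.prod_restrict] at hint
  exact hint.prod_left_ae

theorem locallyIntegrable_integral_section [SecondCountableTopologyEither X Y] [T2Space X]
    [T2Space Y] [LocallyCompactSpace Y] [OpensMeasurableSpace X] [OpensMeasurableSpace Y]
    (hu : LocallyIntegrable u (μ.prod ν)) {η : X → ℝ} (hη : Continuous η)
    (hηc : HasCompactSupport η) : LocallyIntegrable (fun y => ∫ x, u (x, y) * η x ∂μ) ν := by
  refine locallyIntegrable_iff.2 fun C hC => ?_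
  have hprod : IntegrableOn (fun p : X × Y => u p * η p.1) (tsupport η ×ˢ C) (μ.prod ν) :=
    (hu.integrableOn_isCompact (hηc.isCompact.prod hC)).mul_continuousOn
      (hη.comp continuous_fst).continuousOn (hηc.isCompact.prod hC)
  have hstrip : IntegrableOn (fun p : X × Y => u p * η p.1) (univ ×ˢ C) (μ.prod ν) := by
    refine hprod.of_forall_sdiff_eq_zero (.prod .univ hC.measurableSet) fun p hp => ?_
    rw [image_eq_zero_of_notMem_tsupport fun hpη => hp.2 ⟨hpη, hp.1.2⟩, mul_zero]
  rw [IntegrableOn, ← Measure.prod_restrict, Measure.restrict_univ] at hstrip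
  exact hstrip.integral_prod_right

theorem integral_mul_fst_mul_snd [SecondCountableTopologyEither X Y] [T2Space X] [T2Space Y]
    [OpensMeasurableSpace X] [OpensMeasurableSpace Y] (hu : LocallyIntegrable u (μ.prod ν))
    {η : X → ℝ} (hη : Continuous η) (hηc : HasCompactSupport η) {ψ : Y → ℝ} (hψ : Continuous ψ)
    (hψc : HasCompactSupport ψ) :
    ∫ p, u p * (η p.1 * ψ p.2) ∂(μ.prod ν) = ∫ y, ψ y * ∫ x, u (x, y) * η x ∂μ ∂ν := by
  rw [integral_prod_symm _ (integrable_mul_of_tsupport_subset (hu.locallyIntegrableOn univ)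
    (by fun_prop) (hasCompactSupport_fst_mul_snd hηc hψc) (subset_univ _))]
  simp only [← mul_assoc, integral_mul_const, mul_comm (ψ _)]

end Fubini

theorem continuous_setIntegral_mul_continuousMap {X : Type*} [TopologicalSpace X] [T2Space X]
    [LocallyCompactSpace X] [SecondCountableTopology X] [MeasurableSpace X]
    [OpensMeasurableSpace X] {μ : Measure X} {K : Set X} (hK : IsCompact K) {f : X → ℝ}
    (hf : IntegrableOn f K μ) :
    Continuous fun q : C(X, ℝ) => ∫ x in K, f x * q x ∂μ := by
  refine continuous_iff_continuousAt.2 fun q => ?_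
  obtain ⟨M, hM⟩ := hK.exists_bound_of_continuousOn q.continuous.continuousOn
  have hmaps : MapsTo q K (Metric.ball 0 (M + 1)) := fun x hx =>
    mem_ball_zero_iff.2 ((hM x hx).trans_lt (lt_add_one M))
  refine continuousAt_of_dominated (bound := fun x => ‖f x‖ * (M + 1))
    (Eventually.of_forall fun p => hf.1.mul p.continuous.aestronglyMeasurable) ?_
    (hf.norm.mul_const _)
    (ae_of_all _ fun x =>
      (continuous_const.mul (continuous_eval_const x)).continuousAt)
  filter_upwards [ContinuousMap.eventually_mapsTo hK Metric.isOpen_ball hmaps] with p hp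
  filter_upwards [ae_restrict_mem hK.measurableSet] with x hx
  rw [norm_mul]
  exact mul_le_mul_of_nonneg_left (mem_ball_zero_iff.1 (hp hx)).le (norm_nonneg _)

section Sections

variable {F H : Type*} [NormedAddCommGroup F] [NormedSpace ℝ F]
  [MeasureSpace F] [BorelSpace F] [SFinite (volume : Measure F)]
  [NormedAddCommGroup H] [NormedSpace ℝ H] [FiniteDimensional ℝ H]
  [MeasureSpace H] [BorelSpace H] [SFinite (volume : Measure H)]
  {U : Set (F × H)} {w : F} {u v : F × H → ℝ}

theorem HasWeakDirDeriv.ae_integral_section (h : HasWeakDirDeriv U (w, 0) u v)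
    (hu : LocallyIntegrable u) (hv : LocallyIntegrable v) {B : Set H} (hB : IsOpen B)
    {η : F → ℝ} (hη : ContDiff ℝ ∞ η) (hηc : HasCompactSupport η) (hηU : tsupport η ×ˢ B ⊆ U) :
    ∀ᵐ y : H, y ∈ B → ∫ s, u (s, y) * fderiv ℝ η s w = - ∫ s, v (s, y) * η s := by
  have := FiniteDimensional.proper ℝ H
  have hdη := continuous_fderiv_apply_of_contDiff hη w
  have hdηc : HasCompactSupport fun s => fderiv ℝ η s w := hηc.fderiv_apply (𝕜 := ℝ) w
  have hIu := locallyIntegrable_integral_section hu hdη hdηc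
  have hIv := locallyIntegrable_integral_section hv hη.continuous hηc
  suffices ∀ᵐ y : H, y ∈ B → (∫ s, u (s, y) * fderiv ℝ η s w) + ∫ s, v (s, y) * η s = 0 by
    simpa only [add_eq_zero_iff_eq_neg] using this
  refine hB.ae_eq_zero_of_integral_contDiff_smul_eq_zero ((hIu.add hIv).locallyIntegrableOn _)
    fun ψ hψ hψc hψB => ?_
  have htest := hasWeakDirDeriv_iff_integral.1 h (fun p => η p.1 * ψ p.2)
    ((hη.comp contDiff_fst).mul (hψ.comp contDiff_snd)) (hasCompactSupport_fst_mul_snd hηc hψc)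
    (tsupport_fst_mul_snd_subset.trans ((prod_mono_right hψB).trans hηU))
  simp only [fderiv_fst_mul_snd_apply (hη.differentiable (by simp)) (hψ.differentiable (by simp))]
    at htest
  rw [Measure.volume_eq_prod, integral_mul_fst_mul_snd hu hdη hdηc hψ.continuous hψc,
    integral_mul_fst_mul_snd hv hη.continuous hηc hψ.continuous hψc] at htest
  simp only [smul_add]
  rw [integral_add (hIu.integrable_smul_left_of_hasCompactSupport hψ.continuous hψc)
    (hIv.integrable_smul_left_of_hasCompactSupport hψ.continuous hψc)]
  simp only [smul_eq_mul, htest, neg_add_cancel]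

variable [FiniteDimensional ℝ F]

theorem HasWeakDirDeriv.ae_forall_integral_section (h : HasWeakDirDeriv U (w, 0) u v)
    (hu : LocallyIntegrable u) (hv : LocallyIntegrable v) {B : Set H} (hB : IsOpen B)
    {K : Set F} (hK : IsCompact K) :
    ∀ᵐ y : H, y ∈ B → ∀ η : F → ℝ, ContDiff ℝ ∞ η → tsupport η ⊆ K → tsupport η ×ˢ B ⊆ U →
      ∫ s, u (s, y) * fderiv ℝ η s w = - ∫ s, v (s, y) * η s := by
  have := FiniteDimensional.proper ℝ F
  have := FiniteDimensional.proper ℝ H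
  let S : Set (C(F, ℝ) × C(F, ℝ)) := {q | ContDiff ℝ ∞ q.1 ∧ tsupport q.1 ⊆ K ∧
    tsupport q.1 ×ˢ B ⊆ U ∧ ∀ s, q.2 s = fderiv ℝ q.1 s w}
  have hSfst : ∀ (q : S) (f : F → ℝ), ∫ s in K, f s * q.1.1 s = ∫ s, f s * q.1.1 s :=
    fun q f => setIntegral_mul_of_tsupport_subset q.2.2.1
  have hSsnd : ∀ (q : S) (f : F → ℝ),
      ∫ s in K, f s * q.1.2 s = ∫ s, f s * fderiv ℝ q.1.1 s w := fun q f => by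
    simp only [q.2.2.2.2]
    exact setIntegral_mul_of_tsupport_subset
      ((tsupport_fderiv_apply_subset ℝ w).trans q.2.2.1)
  obtain ⟨D, hDc, hD⟩ := TopologicalSpace.exists_countable_dense S
  have haeD : ∀ᵐ y : H, ∀ q ∈ D, y ∈ B →
      ∫ s in K, u (s, y) * q.1.2 s = - ∫ s in K, v (s, y) * q.1.1 s := by
    refine (ae_ball_iff hDc).2 fun q _ => ?_
    simp only [hSfst, hSsnd]
    exact h.ae_integral_section hu hv hB q.2.1
      (hK.of_isClosed_subset (isClosed_tsupport _) q.2.2.1) q.2.2.2.1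
  filter_upwards [haeD, ae_integrableOn_section hu hK, ae_integrableOn_section hv hK]
    with y hy huy hvy hyB η hη hηK hηU
  have hcu : Continuous fun q : S => ∫ s in K, u (s, y) * q.1.2 s :=
    (continuous_setIntegral_mul_continuousMap hK huy).comp
      (continuous_snd.comp continuous_subtype_val)
  have hcv : Continuous fun q : S => - ∫ s in K, v (s, y) * q.1.1 s :=
    ((continuous_setIntegral_mul_continuousMap hK hvy).comp
      (continuous_fst.comp continuous_subtype_val)).neg
  let q : S := ⟨(⟨η, hη.continuous⟩, ⟨_, continuous_fderiv_apply_of_contDiff hη w⟩),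
    hη, hηK, hηU, fun _ => rfl⟩
  have hq := congrFun (hcu.ext_on hD hcv fun q hqD => hy q hqD hyB) q
  rwa [hSfst, hSsnd] at hq

theorem HasWeakDirDeriv.ae_section (h : HasWeakDirDeriv U (w, 0) u v) (hU : IsOpen U)
    (hu : LocallyIntegrable u) (hv : LocallyIntegrable v) :
    ∀ᵐ y : H, HasWeakDirDeriv {s | (s, y) ∈ U} w (fun s => u (s, y)) fun s => v (s, y) := by
  have := FiniteDimensional.proper ℝ F
  have hbasis := TopologicalSpace.isBasis_countableBasis H
  have hae : ∀ᵐ y : H, ∀ B ∈ TopologicalSpace.countableBasis H, ∀ n : ℕ, y ∈ B →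
      ∀ η : F → ℝ, ContDiff ℝ ∞ η → tsupport η ⊆ Metric.closedBall 0 n → tsupport η ×ˢ B ⊆ U →
        ∫ s, u (s, y) * fderiv ℝ η s w = - ∫ s, v (s, y) * η s :=
    (ae_ball_iff (TopologicalSpace.countable_countableBasis H)).2 fun B hB => ae_all_iff.2 fun n =>
      h.ae_forall_integral_section hu hv (hbasis.isOpen hB) (isCompact_closedBall 0 (n : ℝ))
  filter_upwards [hae] with y hy
  refine hasWeakDirDeriv_iff_integral.2 fun η hη hηc hηy => ?_
  obtain ⟨r, hr⟩ := hηc.isCompact.isBounded.subset_closedBall 0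
  obtain ⟨n, hn⟩ := exists_nat_ge r
  obtain ⟨V, W, -, hW, hηV, hyW, hVW⟩ := generalized_tube_lemma (t := {y}) hηc.isCompact
    isCompact_singleton hU (by rintro ⟨s, z⟩ ⟨hs, rfl⟩; exact hηy hs)
  obtain ⟨B, hB, hyB, hBW⟩ := hbasis.exists_subset_of_mem_open (hyW rfl) hW
  exact hy B hB n hyB η hη (hr.trans (Metric.closedBall_subset_closedBall hn))
    ((prod_mono hηV hBW).trans hVW)

theorem MemW.ae_section [IsLocallyFiniteMeasure (volume : Measure (F × H))]
    (h : MemW U (w, 0) u) (hU : IsOpen U) :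
    ∀ᵐ y : H, MemW {s | (s, y) ∈ U} w fun s => u (s, y) := by
  obtain ⟨hu, v, hv, hweak⟩ := h
  have hmem : ∀ {f : F × H → ℝ}, MemLp f 2 (volume.restrict U) → MemLp (U.indicator f) 2 :=
    (memLp_indicator_iff_restrict hU.measurableSet).2
  have hind : ∀ f : F × H → ℝ, U.indicator f =ᵐ[volume.restrict U] f := fun f =>
    indicator_ae_eq_restrict hU.measurableSet
  have hweak' := hweak.congr_ae (hind u) (hind v)
  filter_upwards [hweak'.ae_section hU ((hmem hu).locallyIntegrable one_le_two)
    ((hmem hv).locallyIntegrable one_le_two), ae_memLp_section two_ne_zero ENNReal.ofNat_ne_top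
    (hmem hu), ae_memLp_section two_ne_zero ENNReal.ofNat_ne_top (hmem hv)] with y hy huy hvy
  have hUy : MeasurableSet {s | (s, y) ∈ U} := measurable_prodMk_right hU.measurableSet
  have hW : MemW {s | (s, y) ∈ U} w fun s => U.indicator u (s, y) :=
    ⟨huy.restrict _, _, hvy.restrict _, hy⟩
  refine hW.congr_ae ?_
  filter_upwards [ae_restrict_mem hUy] with s hs using (indicator_of_mem hs u).symm

end Sections

section Hyperplane

variable {d : ℕ} {θ : EuclideanSpace ℝ (Fin d)} {Ω : Set (EuclideanSpace ℝ (Fin d))}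
  {u : EuclideanSpace ℝ (Fin d) → ℝ}

/-- The isometry `(s, y) ↦ s θ + y` from the Euclidean product `ℝ × H_θ` onto `ℝ^d`. -/
noncomputable def lineIsometry (θ : EuclideanSpace ℝ (Fin d)) (hθ : ‖θ‖ = 1) :
    WithLp 2 (ℝ × hyperplane θ) ≃ₗᵢ[ℝ] EuclideanSpace ℝ (Fin d) :=
  (LinearIsometryEquiv.withLpProdCongr 2 (LinearIsometryEquiv.toSpanUnitSingleton θ hθ)
    (LinearIsometryEquiv.refl ℝ (hyperplane θ))).trans
    (Submodule.span ℝ {θ}).orthogonalDecomposition.symm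

/-- The coordinates `(s, y) ↦ s θ + y` on `ℝ^d`, with `ℝ × H_θ` carrying the product norm and the
product measure. -/
noncomputable def lineEquiv (θ : EuclideanSpace ℝ (Fin d)) (hθ : ‖θ‖ = 1) :
    (ℝ × hyperplane θ) ≃L[ℝ] EuclideanSpace ℝ (Fin d) :=
  (WithLp.prodContinuousLinearEquiv 2 ℝ ℝ (hyperplane θ)).symm.trans
    (lineIsometry θ hθ).toContinuousLinearEquiv

theorem lineEquiv_apply (hθ : ‖θ‖ = 1) (s : ℝ) (y : hyperplane θ) :
    lineEquiv θ hθ (s, y) = s • θ + (y : EuclideanSpace ℝ (Fin d)) := by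
  simp [lineEquiv, lineIsometry]

theorem measurePreserving_lineEquiv (hθ : ‖θ‖ = 1) :
    MeasurePreserving (lineEquiv θ hθ) (volume.prod (hyperplaneMeasure θ)) volume :=
  (lineIsometry θ hθ).measurePreserving.comp (WithLp.volume_preserving_toLp ℝ (hyperplane θ))

instance isAddHaarMeasure_hyperplaneMeasure (θ : EuclideanSpace ℝ (Fin d)) :
    Measure.IsAddHaarMeasure (hyperplaneMeasure θ) := by
  unfold hyperplaneMeasure
  infer_instance

theorem ae_of_ae_hyperplane_ae_line (hθ : ‖θ‖ = 1) {p : EuclideanSpace ℝ (Fin d) → Prop}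
    (hp : MeasurableSet {x | p x})
    (h : ∀ᵐ y : hyperplane θ ∂hyperplaneMeasure θ,
      ∀ᵐ s : ℝ, p (s • θ + (y : EuclideanSpace ℝ (Fin d)))) :
    ∀ᵐ x, p x := by
  have hΦ := measurePreserving_lineEquiv hθ
  have hpΦ : MeasurableSet {q | p (lineEquiv θ hθ q)} := hΦ.measurable hp
  rw [← hΦ.map_eq, ae_map_iff hΦ.aemeasurable hp, Measure.ae_prod_iff_ae_ae hpΦ,
    Measure.ae_ae_comm hpΦ]
  simpa only [lineEquiv_apply] using h

theorem isOpen_lineSection (hΩ : IsOpen Ω) (y : hyperplane θ) : IsOpen (lineSection Ω θ y) :=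
  hΩ.preimage (f := fun s : ℝ => s • θ + (y : EuclideanSpace ℝ (Fin d))) (by fun_prop)

theorem right_endpoint_mem_frontier (hΩ : IsOpen Ω) {y : hyperplane θ} {α β : ℝ}
    (h : (α, β) ∈ componentIntervals (lineSection Ω θ y)) :
    β • θ + (y : EuclideanSpace ℝ (Fin d)) ∈ frontier Ω := by
  obtain ⟨hαβ, hsub, -, hβ⟩ := h
  have hmaps : MapsTo (fun s : ℝ => s • θ + (y : EuclideanSpace ℝ (Fin d))) (Ioo α β) Ω := hsub
  have hβmem : β ∈ closure (Ioo α β) := by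
    rw [closure_Ioo hαβ.ne]
    exact right_mem_Icc.2 hαβ.le
  rw [hΩ.frontier_eq]
  exact ⟨hmaps.closure (by fun_prop) hβmem, hβ⟩

theorem MemW.ae_memH1_lineSection (h : MemW Ω θ u) (hΩ : IsOpen Ω) (hθ : ‖θ‖ = 1) :
    ∀ᵐ y ∂hyperplaneMeasure θ,
      MemH1 (lineSection Ω θ y) fun s => u (s • θ + (y : EuclideanSpace ℝ (Fin d))) := by
  let _ : MeasureSpace (hyperplane θ) := measureSpaceOfInnerProductSpace
  have hθ' : lineEquiv θ hθ (1, 0) = θ := by simp [lineEquiv_apply]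
  have hpre : MemW (lineEquiv θ hθ ⁻¹' Ω) (1, 0) (u ∘ lineEquiv θ hθ) :=
    MemW.comp_continuousLinearEquiv _ (measurePreserving_lineEquiv hθ) (hθ'.symm ▸ h)
  have hae := hpre.ae_section (hΩ.preimage (lineEquiv θ hθ).continuous)
  simp only [mem_preimage, Function.comp_apply, lineEquiv_apply] at hae
  exact hae

theorem MemW.ae_memH1_leftLimit (h : MemW Ω θ u) (hΩ : IsOpen Ω) (hθ : ‖θ‖ = 1) :
    ∀ᵐ y ∂hyperplaneMeasure θ, MemH1 (lineSection Ω θ y)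
        (fun s => leftLimit θ u (s • θ + (y : EuclideanSpace ℝ (Fin d)))) ∧
      ∀ α β : ℝ, (α, β) ∈ componentIntervals (lineSection Ω θ y) →
        ContinuousOn (fun s => leftLimit θ u (s • θ + (y : EuclideanSpace ℝ (Fin d))))
          (Ioc α β) := by
  simp only [leftLimit_line]
  filter_upwards [h.ae_memH1_lineSection hΩ hθ] with y hy
  exact ⟨hy.leftLimit (isOpen_lineSection hΩ y),
    fun α β hαβ => hy.continuousOn_leftLimit hαβ.1 hαβ.2.1⟩

theorem MemW.leftLimit_ae_eq (h : MemW Ω θ u) (hΩ : IsOpen Ω) (hθ : ‖θ‖ = 1)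
    (hu : Measurable u) : leftLimit θ u =ᵐ[volume.restrict Ω] u := by
  refine (ae_restrict_iff' hΩ.measurableSet).2 (ae_of_ae_hyperplane_ae_line hθ ?_ ?_)
  · exact hΩ.measurableSet.imp (measurableSet_eq_fun (measurable_leftLimit θ hu) hu)
  filter_upwards [h.ae_memH1_lineSection hΩ hθ] with y hy
  simp only [leftLimit_line]
  exact (ae_restrict_iff' (isOpen_lineSection hΩ y).measurableSet).1
    (hy.leftLimit_ae_eq (isOpen_lineSection hΩ y))

end Hyperplane

theorem mainTheorem2_general (d : ℕ) (Ω : Set (EuclideanSpace ℝ (Fin d))) (hΩ : IsOpen Ω)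
    (θ : EuclideanSpace ℝ (Fin d)) (hθ : ‖θ‖ = 1)
    (u : EuclideanSpace ℝ (Fin d) → ℝ) (hu : MemW Ω θ u) :
    ∃ g : frontier Ω → ℝ, Measurable g ∧ IsDirectionalTrace Ω θ u g := by
  have hum := hu.1.1.aemeasurable
  have hw : MemW Ω θ (hum.mk u) := hu.congr_ae hum.ae_eq_mk.symm
  obtain ⟨A, hA, hgood⟩ := (hw.ae_memH1_leftLimit hΩ hθ).exists_mem
  refine ⟨fun x => leftLimit θ (hum.mk u) x,
    (measurable_leftLimit θ hum.measurable_mk).comp measurable_subtype_coe,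
    leftLimit θ (hum.mk u), (hw.leftLimit_ae_eq hΩ hθ hum.measurable_mk).trans hum.ae_eq_mk.symm,
    shadow Ω θ ∩ A, inter_subset_left, ?_, fun y hy => ⟨(hgood y hy.2).1, fun α β hαβ => ?_⟩⟩
  · rw [sdiff_self_inter]
    exact measure_mono_null (fun y hy => hy.2) (mem_ae_iff.1 hA)
  · exact ⟨_, (hgood y hy.2).2 α β hαβ, fun s _ => rfl, right_endpoint_mem_frontier hΩ hαβ, rfl⟩

theorem mainTheorem2 (d : ℕ) (Ω : Set (EuclideanSpace ℝ (Fin d))) (hΩ : IsOpen Ω)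
    (hΩb : Bornology.IsBounded Ω) (θ : EuclideanSpace ℝ (Fin d)) (hθ : ‖θ‖ = 1)
    (u : EuclideanSpace ℝ (Fin d) → ℝ) (hu : MemW Ω θ u) :
    ∃ g : frontier Ω → ℝ, Measurable g ∧ IsDirectionalTrace Ω θ u g :=
  mainTheorem2_general d Ω hΩ θ hθ u hu
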